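/- Let $\mathbb{K}$ be an arbitrary field and let $n\ge 1$ be an integer. Let $\mathrm{M}_n(\mathbb{K})$ be the vector space of $n\times n$ matrices over $\mathbb{K}$ and $\mathrm{GL}_n(\mathbb{K})\subset \mathrm{M}_n(\mathbb{K})$ the set of invertible ones. For $P,Q\in\mathrm{GL}_n(\mathbb{K})$ let $u_{P,Q}: M\mapsto PMQ$ and $v_{P,Q}: M\mapsto PM^{t}Q$, and let $$\mathcal{G}_n(\mathbb{K})=\{u_{P,Q}\mid P,Q\in\mathrm{GL}_n(\mathbb{K})\}\cup\{v_{P,Q}\mid P,Q\in\mathrm{GL}_n(\mathbb{K})\},$$ a subgroup of the group of automorphisms of the vector space $\mathrm{M}_n(\mathbb{K})$ (the Frobenius group). Then: (i) $\mathcal{G}_n(\mathbb{K})$ is the set of all $\mathbb{K}$-linear endomorphisms $f$ of $\mathrm{M}_n(\mathbb{K})$ such that $f(\mathrm{GL}_n(\mathbb{K}))=\mathrm{GL}_n(\mathbb{K})$. (ii) $\mathcal{G}_n(\mathbb{K})$ is the set of all $\mathbb{K}$-linear endomorphisms $f$ of $\mathrm{M}_n(\mathbb{K})$ such that the inverse image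 $f^{-1}(\mathrm{GL}_n(\mathbb{K}))$ equals $\mathrm{GL}_n(\mathbb{K})$. (iii) $\mathcal{G}_n(\mathbb{K})$ is the set of all bijective $\mathbb{K}$-linear endomorphisms $f$ of $\mathrm{M}_n(\mathbb{K})$ such that $f(\mathrm{GL}_n(\mathbb{K}))\subset\mathrm{GL}_n(\mathbb{K})$. (iv) If $\mathbb{K}$ is algebraically closed, then $\mathcal{G}_n(\mathbb{K})$ is the set of all $\mathbb{K}$-linear endomorphisms $f$ of $\mathrm{M}_n(\mathbb{K})$ such that $f(\mathrm{GL}_n(\mathbb{K}))\subset\mathrm{GL}_n(\mathbb{K})$. -/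

import Mathlib

namespace Frobenius

open Matrix

/-- The set of non-singular (that is, invertible) matrices inside `M_n(K)`. -/
def nonsingular (n : ℕ) (K : Type*) [Field K] : Set (Matrix (Fin n) (Fin n) K) :=
  {M | IsUnit M}

/-- The endomorphism `u_{P,Q} : M ↦ P M Q` of the vector space `M_n(K)`. -/
def u {n : ℕ} {K : Type*} [Field K] (P Q : GL (Fin n) K) :
    Module.End K (Matrix (Fin n) (Fin n) K) where
  toFun M := P.val * M * Q.val
  map_add' A B := by rw [mul_add, add_mul]
  map_smul' c A := by simp

/-- The endomorphism `v_{P,Q} : M ↦ P Mᵀ Q` of the vector space `M_n(K)`. -/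
def v {n : ℕ} {K : Type*} [Field K] (P Q : GL (Fin n) K) :
    Module.End K (Matrix (Fin n) (Fin n) K) where
  toFun M := P.val * Mᵀ * Q.val
  map_add' A B := by rw [transpose_add, mul_add, add_mul]
  map_smul' c A := by simp

/-- The transpose of an invertible matrix, as an invertible matrix. -/
def transposeGL {n : ℕ} {K : Type*} [Field K] (P : GL (Fin n) K) : GL (Fin n) K where
  val := P.valᵀ
  inv := P.invᵀ
  val_inv := by rw [← transpose_mul, P.inv_val, transpose_one]
  inv_val := by rw [← transpose_mul, P.val_inv, transpose_one]

theorem u_one {n : ℕ} {K : Type*} [Field K] : u (1 : GL (Fin n) K) 1 = 1 :=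
  LinearMap.ext fun M => by simp [u]

theorem u_mul_u {n : ℕ} {K : Type*} [Field K] (P Q R S : GL (Fin n) K) :
    u P Q * u R S = u (P * R) (S * Q) :=
  LinearMap.ext fun M => by simp [u, mul_assoc]

theorem u_mul_v {n : ℕ} {K : Type*} [Field K] (P Q R S : GL (Fin n) K) :
    u P Q * v R S = v (P * R) (S * Q) :=
  LinearMap.ext fun M => by simp [u, v, mul_assoc]

theorem v_mul_u {n : ℕ} {K : Type*} [Field K] (P Q R S : GL (Fin n) K) :
    v P Q * u R S = v (P * transposeGL S) (transposeGL R * Q) :=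
  LinearMap.ext fun M => by simp [u, v, transposeGL, mul_assoc]

theorem v_mul_v {n : ℕ} {K : Type*} [Field K] (P Q R S : GL (Fin n) K) :
    v P Q * v R S = u (P * transposeGL S) (transposeGL R * Q) :=
  LinearMap.ext fun M => by simp [u, v, transposeGL, mul_assoc]

/-- The Frobenius group `G_n(K) = {u_{P,Q}} ∪ {v_{P,Q}}`, where `P` and `Q` range over `GL_n(K)`,
as a subgroup of the group `GL(M_n(K))` of automorphisms of the vector space `M_n(K)`. -/
def frobeniusGroup (n : ℕ) (K : Type*) [Field K] :
    Subgroup (LinearMap.GeneralLinearGroup K (Matrix (Fin n) (Fin n) K)) where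
  carrier := {g | (∃ P Q : GL (Fin n) K, g.val = u P Q) ∨ ∃ P Q : GL (Fin n) K, g.val = v P Q}
  one_mem' := Or.inl ⟨1, 1, u_one.symm⟩
  mul_mem' := by
    rintro g h (⟨P, Q, hg⟩ | ⟨P, Q, hg⟩) (⟨R, S, hh⟩ | ⟨R, S, hh⟩)
    · exact Or.inl ⟨_, _, by rw [Units.val_mul, hg, hh, u_mul_u]⟩
    · exact Or.inr ⟨_, _, by rw [Units.val_mul, hg, hh, u_mul_v]⟩
    · exact Or.inr ⟨_, _, by rw [Units.val_mul, hg, hh, v_mul_u]⟩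
    · exact Or.inl ⟨_, _, by rw [Units.val_mul, hg, hh, v_mul_v]⟩
  inv_mem' := by
    rintro g (⟨P, Q, hg⟩ | ⟨P, Q, hg⟩)
    · refine Or.inl ⟨P⁻¹, Q⁻¹, Units.inv_eq_of_mul_eq_one_right ?_⟩
      rw [hg, u_mul_u, mul_inv_cancel, inv_mul_cancel, u_one]
    · refine Or.inr ⟨transposeGL Q⁻¹, transposeGL P⁻¹,
        Units.inv_eq_of_mul_eq_one_right ?_⟩
      rw [hg, v_mul_v]
      have e : ∀ A : GL (Fin n) K, transposeGL (transposeGL A) = A := fun A => Units.ext rfl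
      rw [e, e, mul_inv_cancel, inv_mul_cancel, u_one]

/-- The Frobenius group viewed as a set of endomorphisms of the vector space `M_n(K)`. -/
def frobeniusMaps (n : ℕ) (K : Type*) [Field K] :
    Set (Module.End K (Matrix (Fin n) (Fin n) K)) :=
  {f | ∃ g ∈ frobeniusGroup n K, g.val = f}

end Frobenius

/-!
Every map in the Frobenius group is bijective and preserves invertibility in both directions, so
only the converse inclusions need an argument. They all reduce to a bijective `f` with
`f(GL_n) ⊆ GL_n`.

* If `f(GL_n) = GL_n`, then `f` is surjective because `GL_n` spans `M_n(K)` (`span_nonsingular`).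
* If `f⁻¹(GL_n) = GL_n` and `f A = 0` with `A ≠ 0`, take `d` with `A d ≠ 0` and an invertible `P` with
  `P d = A d`: then `P - A` is singular although `f (P - A) = f P` is not.
* If `K` is algebraically closed and `M` is singular, some invertible `P` has `M + t P` invertible for
  every `t ≠ 0`. As `f P` is invertible, `f M - μ f P` is singular for some `μ`, which has to be `0`;
  so `f M` is singular and `f⁻¹(GL_n) = GL_n` (`isUnit_of_isUnit_apply`).

For `f` bijective with `f(GL_n) ⊆ GL_n` and `n ≥ 2`, pass to the adjoint `h` of `f` for the pairing
`(A, B) ↦ tr (A B)`. For `x ≠ 0` the image `W` under `h` of the space `{x φᵀ}` has dimension `n`, and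
no invertible `P` is orthogonal to `W`: otherwise `φᵀ f(P) x = 0` for all `φ`, so `f(P) x = 0`.
The key is a form of Dieudonné's theorem on spaces of singular matrices: such a `W` contains only
matrices of rank at most one (`exists_GL_trace_eq_zero`). Hence `h` is injective and preserves
matrices of rank at most one, and such maps have the form `M ↦ P M Q` or `M ↦ P Mᵀ Q`
(`exists_GL_of_minorsVanish`). Taking the adjoint again gives the same for `f`.

The theorem of Dieudonné is proved by induction on the size, with the help of an inhomogeneous
version: fewer than `n` consistent affine conditions on an `n × n` matrix have an invertible
solution (`smallSystemsSolvable`). The inductive step (`exists_GL_trace_eq_of_vector`) prescribes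
`P e = c` and leaves a system of conditions on the map induced by `P` from `Kⁿ⁺¹ / K e` to
`Kⁿ⁺¹ / K c`; all depends on choosing `e` and `c` so that enough of the conditions can be met by the
remaining freedom, the `c`-components of the other columns.
-/

namespace Frobenius

open Matrix Module

variable {K : Type*} [Field K]

/-! ### Linear algebra preliminaries -/

theorem exists_GL_mulVec_eq {ι : Type*} [Fintype ι] [DecidableEq ι] {x y : ι → K}
    (hx : x ≠ 0) (hy : y ≠ 0) : ∃ P : GL ι K, P.val *ᵥ x = y := by
  obtain ⟨g, hg⟩ : ∃ g : (ι → K) ≃ₗ[K] (ι → K), g x = y := by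
    obtain ⟨g, hg⟩ := Submodule.exists_linearEquiv_restrict_eq
      ((LinearEquiv.toSpanNonzeroSingleton K _ x hx).symm.trans
        (LinearEquiv.toSpanNonzeroSingleton K _ y hy))
    have h1 : (LinearEquiv.toSpanNonzeroSingleton K _ x hx).symm
        ⟨x, Submodule.mem_span_singleton_self x⟩ = 1 := by
      rw [LinearEquiv.symm_apply_eq, LinearEquiv.toSpanNonzeroSingleton_one]
    refine ⟨g, (hg ⟨x, Submodule.mem_span_singleton_self x⟩).symm.trans ?_⟩
    rw [LinearEquiv.trans_apply, h1, LinearEquiv.toSpanNonzeroSingleton_one]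
  have hu : IsUnit (LinearMap.toMatrix' g.toLinearMap) :=
    (LinearMap.isUnit_toMatrix'_iff).2 ((LinearMap.GeneralLinearGroup.generalLinearEquiv K _).symm g).isUnit
  exact ⟨hu.unit, by simp [LinearMap.toMatrix'_mulVec, hg]⟩

/-- A functional that vanishes on the kernel of `T` factors through `T`. -/
theorem exists_functional_comp_eq {X Y : Type*} [AddCommGroup X] [Module K X] [AddCommGroup Y]
    [Module K Y] (T : X →ₗ[K] Y) (a : X →ₗ[K] K) (h : ∀ x, T x = 0 → a x = 0) :
    ∃ g : Y →ₗ[K] K, ∀ x, g (T x) = a x := by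
  have : a ∈ LinearMap.range T.dualMap := by
    rw [LinearMap.range_dualMap_eq_dualAnnihilator_ker, Submodule.mem_dualAnnihilator]
    exact fun x hx => h x hx
  obtain ⟨g, rfl⟩ := this
  exact ⟨g, fun _ => rfl⟩

/-- Fewer than `m` independent affine conditions on a vector of `K^m` have a nonzero solution: for
`a = 0` the solution set is a nonzero subspace, for `a ≠ 0` it does not contain `0`. -/
theorem exists_ne_zero_dotProduct_eq {m : ℕ} (Φ : Submodule K (Fin m → K)) (hΦ : finrank K Φ < m)
    (a : Φ →ₗ[K] K) : ∃ c : Fin m → K, c ≠ 0 ∧ ∀ φ : Φ, φ.val ⬝ᵥ c = a φ := by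
  obtain ⟨g, hg⟩ := LinearMap.exists_extend a
  have key : ∀ (g : (Fin m → K) →ₗ[K] K) φ, φ ⬝ᵥ (fun i => g (Pi.single i 1)) = g φ := by
    intro g φ
    conv_rhs => rw [pi_eq_sum_univ' φ]
    simp [dotProduct, map_sum]
  by_cases h0 : g = 0
  · have hlt : Φ < ⊤ := by
      refine lt_top_iff_ne_top.2 fun h => ?_
      rw [h, finrank_top, finrank_fin_fun] at hΦ
      exact lt_irrefl _ hΦ
    obtain ⟨g', hg', hle⟩ := Submodule.exists_le_ker_of_lt_top Φ hlt
    refine ⟨fun i => g' (Pi.single i 1), fun h => hg' ?_, fun φ => ?_⟩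
    · ext i; simpa using congrFun h i
    · rw [key, show g' φ = 0 from hle φ.2, ← hg, h0]; simp
  · refine ⟨fun i => g (Pi.single i 1), fun h => h0 ?_, fun φ => ?_⟩
    · ext i; simpa using congrFun h i
    · rw [key, ← hg]; rfl

/-! ### Invertible solutions of small systems of linear equations -/

/-- The matrix with block form `[[1, r], [0, A]]`. -/
def bordered {n : ℕ} (r : Fin n → K) (A : Matrix (Fin n) (Fin n) K) :
    Matrix (Fin (n + 1)) (Fin (n + 1)) K :=
  of (Fin.cons (Fin.cons 1 r) fun i => Fin.cons 0 (A i))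

theorem det_bordered {n : ℕ} (r : Fin n → K) (A : Matrix (Fin n) (Fin n) K) :
    (bordered r A).det = A.det := by
  rw [det_succ_column_zero, Fin.sum_univ_succ]
  simp [bordered, submatrix]
  rfl

theorem trace_bordered_mul {n : ℕ} (r : Fin n → K) (A : Matrix (Fin n) (Fin n) K)
    (B : Matrix (Fin (n + 1)) (Fin (n + 1)) K) :
    trace (bordered r A * B) =
      B 0 0 + ∑ j, r j * B j.succ 0 + trace (A * B.submatrix Fin.succ Fin.succ) := by
  simp [trace, mul_apply, Fin.sum_univ_succ, bordered]

variable (K) in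
/-- Every system of fewer than `n` independent affine conditions on an `n × n` matrix has an invertible
solution. The conditions are indexed by a subspace `W`: the one of `B ∈ W` is `tr (P B) = α B`. -/
def SmallSystemsSolvable (n : ℕ) : Prop :=
  ∀ (W : Submodule K (Matrix (Fin n) (Fin n) K)) (α : W →ₗ[K] K), finrank K W < n →
    ∃ P : GL (Fin n) K, ∀ B : W, trace (P.val * B.val) = α B

/-- Solving a system of size `n + 1` with first column of `P` equal to `e₀`, where `P` is sought as
`[[1, r], [0, A]]`. The conditions are parametrized by a linear map `β`, not assumed injective.
Those of `X'` do not involve `r` and form the system for `A`, which is consistent by `h1`; the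
row `r` then meets the others. -/
theorem exists_GL_trace_eq_of_column_zero {n : ℕ} (hS : SmallSystemsSolvable K n)
    {X : Type*} [AddCommGroup X] [Module K X] [FiniteDimensional K X]
    (β : X →ₗ[K] Matrix (Fin (n + 1)) (Fin (n + 1)) K) (α : X →ₗ[K] K)
    (h1 : ∀ x, (∀ i j, β x (Fin.succ i) j = 0) → α x = β x 0 0)
    (X' : Submodule K X) (hX' : ∀ x, x ∈ X' ↔ ∀ i, β x (Fin.succ i) 0 = 0)
    (h2 : finrank K X' < n ∨
      finrank K X' ≤ n ∧ ∃ x, x ≠ 0 ∧ ∀ i j, β x (Fin.succ i) j = 0) :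
    ∃ P : GL (Fin (n + 1)) K, ∀ x, trace (P.val * β x) = α x := by
  let β' : X' →ₗ[K] Matrix (Fin n) (Fin n) K :=
    { toFun := fun x => (β x.val).submatrix Fin.succ Fin.succ
      map_add' := fun x y => by ext; simp
      map_smul' := fun a x => by ext; simp }
  let α' : X' →ₗ[K] K :=
    { toFun := fun x => α x - β x.val 0 0
      map_add' := fun x y => by simp; ring
      map_smul' := fun a x => by simp; ring }
  have hker : ∀ x, β' x = 0 → α' x = 0 := by
    intro x hx
    refine sub_eq_zero.2 (h1 x fun i j => ?_)
    refine Fin.cases ((hX' x).1 x.2 i) (fun j => ?_) j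
    exact congrFun (congrFun hx i) j
  have hr : finrank K (LinearMap.range β') < n := by
    have h := LinearMap.finrank_range_add_finrank_ker β'
    rcases h2 with h2 | ⟨h2, x, hx0, hx⟩
    · omega
    · have : 0 < finrank K (LinearMap.ker β') := by
        have hx' : (⟨x, (hX' x).2 fun i => hx i 0⟩ : X') ∈ LinearMap.ker β' := by
          ext i j; exact hx i j.succ
        refine finrank_pos_iff_exists_ne_zero.2 ⟨⟨_, hx'⟩, fun h => hx0 ?_⟩
        exact congrArg (fun y => y.val.val) h
      omega
  obtain ⟨g, hg⟩ := exists_functional_comp_eq β' α' hker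
  obtain ⟨A, hA⟩ := hS (LinearMap.range β') (g.comp (Submodule.subtype _)) hr
  have hA' : ∀ x : X', trace (A.val * (β x.val).submatrix Fin.succ Fin.succ)
      = α x - β x.val 0 0 := fun x => (hA ⟨β' x, x, rfl⟩).trans (hg x)
  let T : X →ₗ[K] (Fin n → K) :=
    { toFun := fun x i => β x i.succ 0
      map_add' := fun x y => by ext; simp
      map_smul' := fun a x => by ext; simp }
  let a : X →ₗ[K] K :=
    { toFun := fun x => α x - β x 0 0 - trace (A.val * (β x).submatrix Fin.succ Fin.succ)
      map_add' := fun x y => by simp [submatrix_add, mul_add]; ring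
      map_smul' := fun c x => by simp [submatrix_smul]; ring }
  -- `a` is what the row `r` has to contribute; by the choice of `A` it vanishes on `X' = ker T`.
  obtain ⟨r, hr'⟩ := exists_functional_comp_eq T a fun x hx => by
    have := hA' ⟨x, (hX' x).2 fun i => congrFun hx i⟩
    exact sub_eq_zero.2 this.symm
  have hu : IsUnit (bordered (fun i => r (Pi.single i 1)) A.val) := by
    rw [isUnit_iff_isUnit_det, det_bordered, ← isUnit_iff_isUnit_det]
    exact A.isUnit
  refine ⟨hu.unit, fun x => ?_⟩
  rw [IsUnit.unit_spec, trace_bordered_mul]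
  have h3 : ∑ j, r (Pi.single j 1) * β x j.succ 0 = r (T x) := by
    conv_rhs => rw [pi_eq_sum_univ' (T x)]
    simp [map_sum, T, mul_comm]
  rw [h3, hr']
  simp only [a, LinearMap.coe_mk, AddHom.coe_mk]
  ring

/-- Solving a system of size `n + 1` with `P e = c`. The conditions of `W` that involve only `P e` are
those of the matrices `e φᵀ`, and `h1` says that `c` satisfies them. The conditions in `X` bear on
the map induced modulo `e` and `c`; when `W` contains some `e φᵀ ≠ 0`, that one becomes trivial
there, which explains the alternative in `h2`. -/
theorem exists_GL_trace_eq_of_vector {n : ℕ} (hS : SmallSystemsSolvable K n)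
    {e c : Fin (n + 1) → K} (he : e ≠ 0) (hc : c ≠ 0)
    (W : Submodule K (Matrix (Fin (n + 1)) (Fin (n + 1)) K)) (α : W →ₗ[K] K)
    (h1 : ∀ (B : W) φ, B.val = vecMulVec e φ → α B = φ ⬝ᵥ c)
    (X : Submodule K W) (hX : ∀ B : W, B ∈ X ↔ B.val *ᵥ c ∈ K ∙ e)
    (h2 : finrank K X < n ∨
      finrank K X ≤ n ∧ ∃ φ, φ ≠ 0 ∧ vecMulVec e φ ∈ W) :
    ∃ P : GL (Fin (n + 1)) K, ∀ B : W, trace (P.val * B.val) = α B := by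
  have h0 : (Pi.single 0 1 : Fin (n + 1) → K) ≠ 0 := by simp
  obtain ⟨U, hU⟩ := exists_GL_mulVec_eq he h0
  obtain ⟨V, hV⟩ := exists_GL_mulVec_eq h0 hc
  have hU' : (U⁻¹).val *ᵥ Pi.single 0 1 = e := by
    rw [← hU, mulVec_mulVec, ← Units.val_mul]; simp
  let β : W →ₗ[K] Matrix (Fin (n + 1)) (Fin (n + 1)) K :=
    { toFun := fun B => U.val * B.val * V.val
      map_add' := fun x y => by simp [mul_add, add_mul]
      map_smul' := fun a x => by simp }
  have hβ : ∀ B : W, β B = U.val * B.val * V.val := fun _ => rfl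
  have hcol : ∀ (B : W) i, β B i 0 = (U.val *ᵥ (B.val *ᵥ c)) i := by
    intro B i
    rw [hβ, ← hV, mulVec_mulVec, mulVec_mulVec, mulVec_single_one]
    rfl
  have hvec : ∀ φ, U.val * vecMulVec e φ * V.val = vecMulVec (Pi.single 0 1) (φ ᵥ* V.val) := by
    intro φ
    rw [mul_vecMulVec, vecMulVec_mul, hU]
  have hrow : ∀ B : W, (∀ i j, β B (Fin.succ i) j = 0) → ∃ φ, B.val = vecMulVec e φ := by
    intro B h
    refine ⟨β B 0 ᵥ* (V⁻¹).val, ?_⟩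
    have : β B = vecMulVec (Pi.single 0 1) (β B 0) := by
      ext i j
      refine Fin.cases ?_ (fun i => ?_) i
      · simp [vecMulVec_apply]
      · simp [vecMulVec_apply, h]
    rw [← hU', ← vecMulVec_mul, ← mul_vecMulVec, ← this, hβ]
    simp [mul_assoc]
  suffices h : ∃ P : GL (Fin (n + 1)) K, ∀ B, trace (P.val * β B) = α B by
    obtain ⟨P, hP⟩ := h
    refine ⟨V * P * U, fun B => ?_⟩
    rw [← hP, hβ, Units.val_mul, Units.val_mul, mul_assoc, mul_assoc, trace_mul_comm]
    simp [mul_assoc]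
  refine exists_GL_trace_eq_of_column_zero hS β α ?_ X ?_ ?_
  · intro B hB
    obtain ⟨φ, hφ⟩ := hrow B hB
    rw [h1 B φ hφ, hβ, hφ, hvec, vecMulVec_apply, ← hV, dotProduct_mulVec]
    simp
  · intro B
    rw [hX, Submodule.mem_span_singleton]
    constructor
    · rintro ⟨a, ha⟩ i
      rw [hcol, ← ha, mulVec_smul, hU]; simp
    · intro h
      refine ⟨β B 0 0, ?_⟩
      have : U.val *ᵥ (B.val *ᵥ c) = β B 0 0 • Pi.single 0 1 := by
        ext i
        rw [← hcol]
        refine Fin.cases ?_ (fun i => ?_) i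
        · simp
        · simp [h]
      rw [← hU', ← mulVec_smul, ← this, mulVec_mulVec, ← Units.val_mul]
      simp
  · refine h2.imp_right fun ⟨h, φ, hφ, hW⟩ => ⟨h, ⟨_, hW⟩, ?_, ?_⟩
    · intro h
      rw [Submodule.mk_eq_zero, vecMulVec_eq_zero] at h
      exact h.elim he hφ
    · intro i j
      rw [hβ, hvec, vecMulVec_apply]; simp

theorem smallSystemsSolvable (n : ℕ) : SmallSystemsSolvable K n := by
  induction n with
  | zero => exact fun W α h => absurd h (Nat.not_lt_zero _)
  | succ n ih =>
    intro W α hW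
    by_cases hbot : W = ⊥
    · subst hbot
      refine ⟨1, fun B => ?_⟩
      rw [Subsingleton.elim B 0]; simp
    obtain ⟨B₀, hB₀, hne⟩ := W.ne_bot_iff.1 hbot
    obtain ⟨d, hd⟩ : ∃ d, B₀ *ᵥ d ≠ 0 := by
      by_contra! h
      exact hne (Matrix.ext_of_mulVec_single fun i => (h (Pi.single i 1)).trans (zero_mulVec _).symm)
    have hpos : 0 < finrank K W := finrank_pos_iff_exists_ne_zero.2 ⟨⟨B₀, hB₀⟩, by simpa using hne⟩
    -- With such an `e`, the choice `c = d` works unless some condition bears on `P e` alone.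
    obtain ⟨e, he⟩ : ∃ e, e ∉ K ∙ (B₀ *ᵥ d) := by
      by_contra! h
      have h' := finrank_span_singleton (K := K) hd
      rw [(Submodule.eq_top_iff'.2 h), finrank_top, finrank_fin_fun] at h'
      omega
    have he0 : e ≠ 0 := by rintro rfl; exact he (Submodule.zero_mem _)
    let X (c : Fin (n + 1) → K) : Submodule K W := ((K ∙ e).comap
      ((mulVecBilin K K).flip c :
        Matrix (Fin (n + 1)) (Fin (n + 1)) K →ₗ[K] (Fin (n + 1) → K))).comap W.subtype
    by_cases hφ : ∃ φ, φ ≠ 0 ∧ vecMulVec e φ ∈ W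
    · let J : (Fin (n + 1) → K) →ₗ[K] Matrix (Fin (n + 1)) (Fin (n + 1)) K := vecMulVecBilin K K e
      have hJ : Function.Injective J := by
        rw [injective_iff_map_eq_zero]
        intro φ h
        exact (vecMulVec_eq_zero.1 h).resolve_left he0
      have hle : finrank K (W.comap J) ≤ finrank K W :=
        LinearMap.finrank_le_finrank_of_injective (f := J.restrict (p := W.comap J) (q := W)
          fun _ h => h) fun x y h => Subtype.ext (hJ (congrArg Subtype.val h))
      obtain ⟨c, hc, hcα⟩ := exists_ne_zero_dotProduct_eq (W.comap J) (hle.trans_lt hW)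
        (α.comp (J.restrict (p := W.comap J) (q := W) fun _ h => h))
      refine exists_GL_trace_eq_of_vector ih he0 hc W α ?_ (X c) (fun B => Iff.rfl)
        (Or.inr ⟨(Submodule.finrank_le _).trans (Nat.lt_succ_iff.1 hW), hφ⟩)
      intro B φ hB
      rw [hcα ⟨φ, show vecMulVec e φ ∈ W from hB ▸ B.2⟩]
      exact congrArg α (Subtype.ext hB)
    · push Not at hφ
      have hd0 : d ≠ 0 := by rintro rfl; simp at hd
      refine exists_GL_trace_eq_of_vector ih he0 hd0 W α ?_ (X d) (fun B => Iff.rfl) (Or.inl ?_)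
      · intro B φ hB
        by_cases h : φ = 0
        · subst h
          have : B = 0 := Subtype.ext (by simpa using hB)
          simp [this]
        · exact absurd (hB ▸ B.2) (hφ φ h)
      · have : X d < ⊤ := by
          refine lt_top_iff_ne_top.2 fun h => ?_
          have : B₀ *ᵥ d ∈ K ∙ e := (h ▸ Submodule.mem_top : (⟨B₀, hB₀⟩ : W) ∈ X d)
          obtain ⟨a, ha⟩ := Submodule.mem_span_singleton.1 this
          have ha0 : a ≠ 0 := by rintro rfl; exact hd (by rw [← ha, zero_smul])
          exact he (Submodule.mem_span_singleton.2 ⟨a⁻¹, by rw [← ha, inv_smul_smul₀ ha0]⟩)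
        have := Submodule.finrank_lt this.ne
        omega

/-! ### Matrices of rank at most one -/

/-- All `2 × 2` minors of `M` vanish, which over a field means that `M` has rank at most one. -/
def MinorsVanish {m n : Type*} (M : Matrix m n K) : Prop :=
  ∀ i k j l, M i j * M k l = M i l * M k j

theorem minorsVanish_vecMulVec {m n : Type*} (a : m → K) (b : n → K) :
    MinorsVanish (vecMulVec a b) := by
  intro i k j l
  simp only [vecMulVec_apply]; ring

theorem MinorsVanish.smul {m n : Type*} {M : Matrix m n K} (h : MinorsVanish M) (s : K) :
    MinorsVanish (s • M) := by
  intro i k j l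
  simp only [Matrix.smul_apply, smul_eq_mul]
  linear_combination s ^ 2 * h i k j l

theorem MinorsVanish.transpose {m n : Type*} {M : Matrix m n K} (h : MinorsVanish M) :
    MinorsVanish Mᵀ := by
  intro i k j l
  simp only [transpose_apply]
  linear_combination h j l i k

theorem MinorsVanish.exists_eq_vecMulVec {m n : Type*} {M : Matrix m n K} (h : MinorsVanish M) :
    ∃ a b, M = vecMulVec a b := by
  by_cases h0 : M = 0
  · exact ⟨0, 0, by rw [h0]; ext; simp [vecMulVec_apply]⟩
  obtain ⟨i, j, hij⟩ : ∃ i j, M i j ≠ 0 := by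
    by_contra! h'
    exact h0 (Matrix.ext h')
  refine ⟨fun k => M k j, fun l => M i l / M i j, Matrix.ext fun k l => ?_⟩
  rw [vecMulVec_apply]
  field_simp
  linear_combination h i k j l

theorem exists_eq_smul_of_mul_eq_mul {ι : Type*} {x y : ι → K} (hx : x ≠ 0)
    (h : ∀ i k, x i * y k = x k * y i) : ∃ s : K, y = s • x := by
  obtain ⟨i, hi⟩ := Function.ne_iff.1 hx
  simp only [Pi.zero_apply] at hi
  refine ⟨y i / x i, funext fun k => ?_⟩
  simp only [Pi.smul_apply, smul_eq_mul]
  field_simp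
  linear_combination h i k

/-- If `B` has rank at least two and `C c` is parallel to `B c` for every `c`, then `C` is a multiple
of `B`. -/
theorem mem_span_of_locally_dependent {m n : Type*} [Fintype n] [DecidableEq n]
    {B C : Matrix m n K} (hB : ¬ MinorsVanish B)
    (h : ∀ (c : n → K) i k, (B *ᵥ c) i * (C *ᵥ c) k = (B *ᵥ c) k * (C *ᵥ c) i) :
    C ∈ K ∙ B := by
  simp only [MinorsVanish, not_forall] at hB
  obtain ⟨i, k, j, l, hne⟩ := hB
  set x : n → K := Pi.single j 1
  set y : n → K := Pi.single l 1
  have hcross : (B *ᵥ x) i * (B *ᵥ y) k ≠ (B *ᵥ y) i * (B *ᵥ x) k := by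
    simpa [x, y] using hne
  have hx : B *ᵥ x ≠ 0 := fun h0 => hcross (by simp [h0])
  have hy : B *ᵥ y ≠ 0 := fun h0 => hcross (by simp [h0])
  have hxy : B *ᵥ (x + y) ≠ 0 := by
    intro h0
    rw [mulVec_add] at h0
    refine hcross ?_
    rw [eq_neg_of_add_eq_zero_left h0]; simp
  obtain ⟨a, ha⟩ := exists_eq_smul_of_mul_eq_mul hx (h x)
  obtain ⟨b, hb⟩ := exists_eq_smul_of_mul_eq_mul hy (h y)
  obtain ⟨d, hd⟩ := exists_eq_smul_of_mul_eq_mul hxy (h (x + y))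
  rw [mulVec_add, mulVec_add, ha, hb] at hd
  have e1 := congrFun hd i
  have e2 := congrFun hd k
  simp only [Pi.add_apply, Pi.smul_apply, smul_eq_mul] at e1 e2
  have hda : d = a := by
    have : (a - d) * ((B *ᵥ x) i * (B *ᵥ y) k - (B *ᵥ y) i * (B *ᵥ x) k) = 0 := by
      linear_combination (B *ᵥ y) k * e1 - (B *ᵥ y) i * e2
    exact (sub_eq_zero.1 ((mul_eq_zero.1 this).resolve_right (sub_ne_zero.2 hcross))).symm
  have hdb : d = b := by
    have : (b - d) * ((B *ᵥ x) i * (B *ᵥ y) k - (B *ᵥ y) i * (B *ᵥ x) k) = 0 := by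
      linear_combination (B *ᵥ x) i * e2 - (B *ᵥ x) k * e1
    exact (sub_eq_zero.1 ((mul_eq_zero.1 this).resolve_right (sub_ne_zero.2 hcross))).symm
  subst hda
  subst hdb
  -- `C - d B` kills `x` and `y`. If it did not kill `c`, then its value at `c`, `c + x` and `c + y`
  -- would be the same nonzero vector, parallel to `B c`, `B (c + x)` and `B (c + y)`, hence to
  -- `B x` and `B y`.
  refine Submodule.mem_span_singleton.2 ⟨d, ?_⟩
  refine Matrix.ext_of_mulVec_single fun p => ?_
  set c : n → K := Pi.single p 1
  by_contra hne0
  have hD : C *ᵥ c - d • (B *ᵥ c) ≠ 0 := by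
    rw [sub_ne_zero, ← smul_mulVec]; exact Ne.symm hne0
  have hdep : ∀ z : n → K, C *ᵥ z = d • (B *ᵥ z) →
      ∃ s : K, B *ᵥ (c + z) = s • (C *ᵥ c - d • (B *ᵥ c)) := by
    intro z hz
    refine exists_eq_smul_of_mul_eq_mul hD fun i k => ?_
    have := h (c + z) k i
    rw [mulVec_add C, hz] at this
    rw [mulVec_add B] at this ⊢
    simp only [Pi.add_apply, Pi.sub_apply, Pi.smul_apply, smul_eq_mul] at this ⊢
    linear_combination this
  obtain ⟨s₀, h₀⟩ := hdep 0 (by simp)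
  obtain ⟨s₁, h₁⟩ := hdep x ha
  obtain ⟨s₂, h₂⟩ := hdep y hb
  rw [add_zero] at h₀
  generalize C *ᵥ c - d • (B *ᵥ c) = w at h₀ h₁ h₂
  rw [mulVec_add, h₀, ← eq_sub_iff_add_eq', ← sub_smul] at h₁ h₂
  refine hcross ?_
  rw [h₁, h₂]
  simp only [Pi.smul_apply, smul_eq_mul]
  ring

/-! ### Spaces of matrices orthogonal to no invertible matrix -/

/-- The case of size at least three of `exists_GL_trace_eq_zero`. Some `c` has
`W c = {B c | B ∈ W}` of dimension at least two. If `W c` is proper, prescribing `P e = c` for any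
`e ∉ W c` works. Otherwise `B ↦ B c` is injective on `W`, and `e = B₀ c` works because the matrices
of `W` with image in `K e` are multiples of `B₀`, which has rank at least two. -/
theorem exists_GL_trace_eq_zero_of_three_le {n : ℕ} (hn : 2 ≤ n)
    (W : Submodule K (Matrix (Fin (n + 1)) (Fin (n + 1)) K)) (hW : finrank K W = n + 1)
    {B₀ : Matrix (Fin (n + 1)) (Fin (n + 1)) K} (hB₀ : B₀ ∈ W) (hmin : ¬ MinorsVanish B₀) :
    ∃ P : GL (Fin (n + 1)) K, ∀ B ∈ W, trace (P.val * B) = 0 := by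
  let ev (c : Fin (n + 1) → K) : W →ₗ[K] (Fin (n + 1) → K) :=
    ((mulVecBilin K K).flip c : Matrix (Fin (n + 1)) (Fin (n + 1)) K →ₗ[K] _).comp W.subtype
  have hev : ∀ c B, ev c B = B.val *ᵥ c := fun _ _ => rfl
  obtain ⟨c, hc⟩ : ∃ c, 2 ≤ finrank K (LinearMap.range (ev c)) := by
    by_contra! h
    have hle : W ≤ K ∙ B₀ := by
      intro C hC
      refine mem_span_of_locally_dependent hmin fun c i k => ?_
      obtain ⟨v, hv⟩ := finrank_le_one_iff.1 (Nat.lt_succ_iff.1 (h c))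
      obtain ⟨a, ha⟩ := hv ⟨ev c ⟨B₀, hB₀⟩, _, rfl⟩
      obtain ⟨b, hb⟩ := hv ⟨ev c ⟨C, hC⟩, _, rfl⟩
      have ha' : a • v.val = B₀ *ᵥ c := congrArg Subtype.val ha
      have hb' : b • v.val = C *ᵥ c := congrArg Subtype.val hb
      rw [← ha', ← hb']
      simp only [Pi.smul_apply, smul_eq_mul]
      ring
    have := (Submodule.finrank_mono hle).trans (finrank_span_le_card _)
    simp at this
    omega
  have hc0 : c ≠ 0 := by
    rintro rfl
    have : ev 0 = 0 := by ext; simp [hev]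
    rw [this, LinearMap.range_zero, finrank_bot] at hc
    omega
  have hrn := LinearMap.finrank_range_add_finrank_ker (ev c)
  suffices h : ∃ e : Fin (n + 1) → K, e ≠ 0 ∧
      (∀ (B : W) φ, B.val = vecMulVec e φ → φ ⬝ᵥ c = 0) ∧
      finrank K ((K ∙ e).comap (ev c)) < n by
    obtain ⟨e, he, h1, h2⟩ := h
    obtain ⟨P, hP⟩ := exists_GL_trace_eq_of_vector (smallSystemsSolvable n) he hc0 W 0
      (fun B φ h => (h1 B φ h).symm) ((K ∙ e).comap (ev c)) (fun B => Iff.rfl) (Or.inl h2)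
    exact ⟨P, fun B hB => hP ⟨B, hB⟩⟩
  have hvec : ∀ (B : W) e φ, B.val = vecMulVec e φ → ev c B = (φ ⬝ᵥ c) • e := by
    intro B e φ h
    rw [hev, h, vecMulVec_mulVec]; simp
  by_cases htop : LinearMap.range (ev c) = ⊤
  · have hinj : Function.Injective (ev c) := by
      rw [htop, finrank_top, finrank_fin_fun, hW] at hrn
      rw [← LinearMap.ker_eq_bot, ← Submodule.finrank_eq_zero (R := K)]
      omega
    have hne : (⟨B₀, hB₀⟩ : W) ≠ 0 := by
      intro h
      refine hmin ?_
      rw [show B₀ = 0 from congrArg Subtype.val h]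
      intro i j k l; simp
    refine ⟨ev c ⟨B₀, hB₀⟩, fun h => hne (hinj (h.trans (map_zero _).symm)), fun B φ h => ?_, ?_⟩
    · by_contra hφ
      have h1 := hvec B _ φ h
      rw [← map_smul] at h1
      have h2 : B.val = (φ ⬝ᵥ c) • B₀ := congrArg Subtype.val (hinj h1)
      refine hmin ?_
      rw [← inv_smul_smul₀ hφ B₀, ← h2, h]
      exact (minorsVanish_vecMulVec _ _).smul _
    · have hle : (K ∙ ev c ⟨B₀, hB₀⟩).comap (ev c) ≤ K ∙ (⟨B₀, hB₀⟩ : W) := by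
        intro B hB
        obtain ⟨a, ha⟩ := Submodule.mem_span_singleton.1 hB
        rw [← map_smul] at ha
        exact Submodule.mem_span_singleton.2 ⟨a, hinj ha⟩
      have := Submodule.finrank_mono hle
      rw [finrank_span_singleton hne] at this
      omega
  · obtain ⟨e, he⟩ : ∃ e, e ∉ LinearMap.range (ev c) := by
      by_contra! h
      exact htop (Submodule.eq_top_iff'.2 h)
    have hsmul : ∀ (B : W) (a : K), ev c B = a • e → a = 0 := by
      intro B a h
      by_contra ha
      exact he ⟨a⁻¹ • B, by rw [map_smul, h, inv_smul_smul₀ ha]⟩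
    refine ⟨e, ?_, fun B φ h => hsmul B _ (hvec B e φ h), ?_⟩
    · rintro rfl
      exact he (Submodule.zero_mem _)
    · have hle : (K ∙ e).comap (ev c) ≤ LinearMap.ker (ev c) := by
        intro B hB
        obtain ⟨a, ha⟩ := Submodule.mem_span_singleton.1 hB
        have h0 := hsmul B a ha.symm
        rw [LinearMap.mem_ker, ← ha, h0, zero_smul]
      have := Submodule.finrank_mono hle
      omega

theorem exists_isUnit_trace_eq_zero_fin_two (N : Matrix (Fin 2) (Fin 2) K) :
    ∃ Q : Matrix (Fin 2) (Fin 2) K, IsUnit Q ∧ trace Q = 0 ∧ trace (Q * N) = 0 := by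
  suffices h : ∃ p q r : K, p ^ 2 + q * r ≠ 0 ∧
      p * (N 0 0 - N 1 1) + q * N 1 0 + r * N 0 1 = 0 by
    obtain ⟨p, q, r, h1, h2⟩ := h
    refine ⟨!![p, q; r, -p], ?_, by simp [trace, Fin.sum_univ_two], ?_⟩
    · rw [isUnit_iff_isUnit_det, det_fin_two_of, isUnit_iff_ne_zero]
      intro h; exact h1 (by linear_combination -h)
    · simp only [trace, Fin.sum_univ_two, mul_apply, diag_apply, of_apply, cons_val', cons_val_zero,
        cons_val_one, cons_val_fin_one]
      linear_combination h2
  by_cases h10 : N 1 0 = 0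
  · by_cases h01 : N 0 1 = 0
    · exact ⟨0, 1, 1, by simp, by simp [h10, h01]⟩
    · exact ⟨N 0 1, 0, N 1 1 - N 0 0, by simpa using h01, by rw [h10]; ring⟩
  · exact ⟨N 1 0, N 1 1 - N 0 0, 0, by simpa using h10, by ring⟩

/-- In size two `B₀` is invertible, and dividing by it makes `W` spanned by `1` and some `N`. -/
theorem exists_GL_trace_eq_zero_fin_two
    (W : Submodule K (Matrix (Fin 2) (Fin 2) K)) (hW : finrank K W = 2)
    {B₀ : Matrix (Fin 2) (Fin 2) K} (hB₀ : B₀ ∈ W) (hmin : ¬ MinorsVanish B₀) :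
    ∃ P : GL (Fin 2) K, ∀ B ∈ W, trace (P.val * B) = 0 := by
  have hu : IsUnit B₀ := by
    rw [isUnit_iff_isUnit_det, det_fin_two, isUnit_iff_ne_zero]
    intro h
    refine hmin fun i k j l => ?_
    fin_cases i <;> fin_cases k <;> fin_cases j <;> fin_cases l <;> simp <;>
      first | linear_combination h | linear_combination -h | ring
  obtain ⟨C, hC, hCB⟩ : ∃ C ∈ W, C ∉ K ∙ B₀ := by
    by_contra! h
    have := (Submodule.finrank_mono (show W ≤ K ∙ B₀ from h)).trans (finrank_span_le_card _)
    simp at this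
    omega
  have hne : B₀ ≠ 0 := hu.ne_zero
  have hspan : Submodule.span K (Set.range ![B₀, C]) = W := by
    have hli : LinearIndependent K ![B₀, C] :=
      (LinearIndependent.pair_iff' hne).2 fun a ha =>
        hCB (Submodule.mem_span_singleton.2 ⟨a, ha⟩)
    refine Submodule.eq_of_le_of_finrank_eq ?_ ?_
    · rw [Submodule.span_le]
      rintro _ ⟨i, rfl⟩
      fin_cases i
      exacts [hB₀, hC]
    · rw [finrank_span_eq_card hli, hW]; simp
  obtain ⟨Q, hQ, h1, h2⟩ := exists_isUnit_trace_eq_zero_fin_two ((hu.unit⁻¹).val * C)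
  refine ⟨hQ.unit * hu.unit⁻¹, fun B hB => ?_⟩
  rw [← hspan, Matrix.range_cons, Matrix.range_cons, Matrix.range_empty, Set.union_empty,
    Set.singleton_union, Submodule.mem_span_pair] at hB
  obtain ⟨s, t, rfl⟩ := hB
  have h3 : (hu.unit⁻¹).val * B₀ = 1 := hu.val_inv_mul
  rw [Units.val_mul, IsUnit.unit_spec, mul_assoc, mul_add, mul_smul_comm, mul_smul_comm, h3,
    mul_add, trace_add, mul_smul_comm, mul_smul_comm, trace_smul, trace_smul, mul_one, h1, h2]
  simp

/-- An `n`-dimensional space of `n × n` matrices containing one of rank at least two is orthogonal to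
some invertible matrix; equivalently, the orthogonal of a singular space of codimension `n` consists
of matrices of rank at most one. -/
theorem exists_GL_trace_eq_zero {n : ℕ} (hn : 2 ≤ n) (W : Submodule K (Matrix (Fin n) (Fin n) K))
    (hW : finrank K W = n) {B₀ : Matrix (Fin n) (Fin n) K} (hB₀ : B₀ ∈ W)
    (hmin : ¬ MinorsVanish B₀) : ∃ P : GL (Fin n) K, ∀ B ∈ W, trace (P.val * B) = 0 := by
  obtain rfl | ⟨m, rfl, hm⟩ : n = 2 ∨ ∃ m, n = m + 1 ∧ 2 ≤ m := by
    rcases hn.eq_or_lt with h | h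
    · exact Or.inl h.symm
    · exact Or.inr ⟨n - 1, by omega, by omega⟩
  · exact exists_GL_trace_eq_zero_fin_two W hW hB₀ hmin
  · exact exists_GL_trace_eq_zero_of_three_le hm W hW hB₀ hmin

/-! ### Linear maps preserving matrices of rank at most one -/

theorem exists_eq_smul_right_of_vecMulVec_eq {m n : Type*} {a x : m → K} {b y : n → K}
    (h : vecMulVec a b = vecMulVec x y) (ha : a ≠ 0) : ∃ t : K, b = t • y := by
  obtain ⟨i, hi⟩ := Function.ne_iff.1 ha
  simp only [Pi.zero_apply] at hi
  refine ⟨x i / a i, funext fun j => ?_⟩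
  have := congrFun (congrFun h i) j
  simp only [vecMulVec_apply] at this
  simp only [Pi.smul_apply, smul_eq_mul]
  field_simp
  linear_combination this

theorem exists_eq_smul_left_of_vecMulVec_eq {m n : Type*} {a x : m → K} {b y : n → K}
    (h : vecMulVec a b = vecMulVec x y) (hb : b ≠ 0) : ∃ t : K, a = t • x := by
  refine exists_eq_smul_right_of_vecMulVec_eq (a := b) (x := y) ?_ hb
  rw [← transpose_vecMulVec, h, transpose_vecMulVec]

/-- The `2 × 2` minors of `a bᵀ + c dᵀ` are the products of a minor of `(a, c)` and one of `(b, d)`. -/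
theorem MinorsVanish.parallel_of_add {m n : Type*} {a c : m → K} {b d : n → K}
    (h : MinorsVanish (vecMulVec a b + vecMulVec c d)) :
    (∀ i k, a i * c k = a k * c i) ∨ (∀ j l, b j * d l = b l * d j) := by
  by_contra! hcon
  obtain ⟨⟨i, k, h1⟩, ⟨j, l, h2⟩⟩ := hcon
  refine mul_ne_zero (sub_ne_zero.2 h1) (sub_ne_zero.2 h2) ?_
  have := h i k j l
  simp only [Matrix.add_apply, vecMulVec_apply] at this
  linear_combination this

/-- In a linear space of matrices of rank at most one, all have a common left or a common right
factor. -/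
theorem exists_common_factor {m n Y : Type*} [AddCommGroup Y] [Module K Y]
    (g : Y →ₗ[K] Matrix m n K) (h : ∀ y, MinorsVanish (g y)) :
    (∃ a, ∀ y, ∃ b, g y = vecMulVec a b) ∨ (∃ b, ∀ y, ∃ a, g y = vecMulVec a b) := by
  by_contra! hcon
  obtain ⟨hA, hB⟩ := hcon
  have hz : ∀ a : m → K, vecMulVec a (0 : n → K) = 0 := fun a => by ext; simp [vecMulVec_apply]
  have hz' : ∀ b : n → K, vecMulVec (0 : m → K) b = 0 := fun b => by ext; simp [vecMulVec_apply]
  obtain ⟨y₁, h₁⟩ := hA 0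
  have hne := h₁ 0
  rw [hz] at hne
  obtain ⟨a₁, b₁, e₁⟩ := (h y₁).exists_eq_vecMulVec
  have ha₁ : a₁ ≠ 0 := by rintro rfl; exact hne (e₁.trans (hz' _))
  have hb₁ : b₁ ≠ 0 := by rintro rfl; exact hne (e₁.trans (hz _))
  obtain ⟨y₂, h₂⟩ := hA a₁
  obtain ⟨y₃, h₃⟩ := hB b₁
  obtain ⟨a₂, b₂, e₂⟩ := (h y₂).exists_eq_vecMulVec
  obtain ⟨a₃, b₃, e₃⟩ := (h y₃).exists_eq_vecMulVec
  have ha₂ : ¬ ∀ i k, a₁ i * a₂ k = a₁ k * a₂ i := by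
    intro hp
    obtain ⟨s, rfl⟩ := exists_eq_smul_of_mul_eq_mul ha₁ hp
    exact h₂ (s • b₂) (by rw [e₂, vecMulVec_smul, smul_vecMulVec])
  have hb₃ : ¬ ∀ i k, b₁ i * b₃ k = b₁ k * b₃ i := by
    intro hp
    obtain ⟨s, rfl⟩ := exists_eq_smul_of_mul_eq_mul hb₁ hp
    exact h₃ (s • a₃) (by rw [e₃, vecMulVec_smul, smul_vecMulVec])
  have h12 := h (y₁ + y₂)
  have h13 := h (y₁ + y₃)
  have h23 := h (y₂ + y₃)
  rw [map_add, e₁, e₂] at h12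
  rw [map_add, e₁, e₃] at h13
  rw [map_add, e₂, e₃] at h23
  obtain ⟨t, rfl⟩ := exists_eq_smul_of_mul_eq_mul hb₁ (h12.parallel_of_add.resolve_left ha₂)
  obtain ⟨s, rfl⟩ := exists_eq_smul_of_mul_eq_mul ha₁ (h13.parallel_of_add.resolve_right hb₃)
  have ht : t ≠ 0 := by rintro rfl; exact h₂ 0 (by rw [e₂, zero_smul, hz, hz])
  have hs : s ≠ 0 := by rintro rfl; exact h₃ 0 (by rw [e₃, zero_smul, hz', hz'])
  rcases h23.parallel_of_add with hp | hp
  · refine ha₂ fun i k => mul_left_cancel₀ hs ?_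
    have := hp k i
    simp only [Pi.smul_apply, smul_eq_mul] at this
    linear_combination this
  · refine hb₃ fun i k => mul_left_cancel₀ ht ?_
    have := hp i k
    simp only [Pi.smul_apply, smul_eq_mul] at this
    linear_combination this

section RankOnePreservers

variable {n : ℕ} {h : Module.End K (Matrix (Fin n) (Fin n) K)}

/-- The matrices supported in row `i` and those supported in column `j` cannot both be sent by `h` to
matrices with a common left factor: the factors `a` and `a'` are parallel, as seen on the matrix
unit at `(i, j)`, and row `i` already fills the whole space of matrices `a bᵀ`. -/
theorem not_row_and_column_left (hinj : Function.Injective h) {i j k : Fin n} (hki : k ≠ i)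
    {a a' : Fin n → K}
    (hrow : ∀ φ, ∃ b, h (vecMulVec (Pi.single i 1) φ) = vecMulVec a b)
    (hcol : ∀ x, ∃ b, h (vecMulVec x (Pi.single j 1)) = vecMulVec a' b) : False := by
  choose T hT using hrow
  obtain ⟨b', hb'⟩ := hcol (Pi.single i 1)
  have hne : vecMulVec a' b' ≠ 0 := by
    rw [← hb', Ne, map_eq_zero_iff h hinj, vecMulVec_eq_zero]
    simp
  rw [Ne, vecMulVec_eq_zero, not_or] at hne
  obtain ⟨s, hs⟩ := exists_eq_smul_left_of_vecMulVec_eq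
    ((hb'.symm.trans (hT (Pi.single j 1)))) hne.2
  have ha : a ≠ 0 := by rintro rfl; exact hne.1 (by rw [hs, smul_zero])
  obtain ⟨p, hp⟩ := Function.ne_iff.1 ha
  simp only [Pi.zero_apply] at hp
  have hTe : ∀ φ l, T φ l = (a p)⁻¹ * h (vecMulVec (Pi.single i 1) φ) p l := by
    intro φ l
    rw [hT, vecMulVec_apply, inv_mul_cancel_left₀ hp]
  let L : (Fin n → K) →ₗ[K] (Fin n → K) :=
    { toFun := T
      map_add' := fun x y => by
        ext l; simp only [hTe, vecMulVec_add, map_add, Matrix.add_apply, Pi.add_apply]; ring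
      map_smul' := fun c x => by
        ext l; simp only [hTe, vecMulVec_smul, map_smul, Matrix.smul_apply, Pi.smul_apply,
          smul_eq_mul, RingHom.id_apply]; ring }
  have hLinj : Function.Injective L := by
    intro φ φ' he
    have he' : T φ = T φ' := he
    have := hinj ((hT φ).trans (he' ▸ (hT φ').symm))
    ext l
    simpa [vecMulVec_apply] using congrFun (congrFun this i) l
  obtain ⟨b, hb⟩ := hcol (Pi.single k 1)
  obtain ⟨φ, hφ⟩ := LinearMap.injective_iff_surjective.1 hLinj (s • b)
  have hφ' : T φ = s • b := hφ
  have : vecMulVec (Pi.single k 1) (Pi.single j 1) = vecMulVec (Pi.single i 1) φ := by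
    apply hinj
    rw [hb, hT, hφ', hs, vecMulVec_smul, smul_vecMulVec]
  have := congrFun (congrFun this k) j
  simp [vecMulVec_apply, hki] at this

/-- Here `h` sends the matrix unit at `(i, j)` to `s i j • a i (b j)ᵀ`, so `h M` is `Y (M ∘ s) Z` for the
entrywise product `M ∘ s`. The image of the all-ones matrix shows that `s` has rank at most one,
and `s = α βᵀ` is absorbed into `Y` and `Z`. -/
theorem exists_GL_of_rows_left_of_columns_right (hinj : Function.Injective h)
    (hmin : ∀ x φ, MinorsVanish (h (vecMulVec x φ)))
    (hrow : ∀ i : Fin n, ∃ a, ∀ φ, ∃ b, h (vecMulVec (Pi.single i 1) φ) = vecMulVec a b)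
    (hcol : ∀ j : Fin n, ∃ b, ∀ x, ∃ a, h (vecMulVec x (Pi.single j 1)) = vecMulVec a b) :
    ∃ P Q : GL (Fin n) K, ∀ M, h M = P.val * M * Q.val := by
  choose a ha using hrow
  choose b hb using hcol
  have hs : ∀ i j, ∃ s : K, h (single i j 1) = s • vecMulVec (a i) (b j) := by
    intro i j
    obtain ⟨b', hb'⟩ := ha i (Pi.single j 1)
    obtain ⟨a', ha'⟩ := hb j (Pi.single i 1)
    have hne : vecMulVec (a i) b' ≠ 0 := by
      rw [← hb', Ne, map_eq_zero_iff h hinj, vecMulVec_eq_zero]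
      simp
    rw [Ne, vecMulVec_eq_zero, not_or] at hne
    obtain ⟨s, rfl⟩ := exists_eq_smul_right_of_vecMulVec_eq (hb'.symm.trans ha') hne.1
    exact ⟨s, by rw [single_eq_single_vecMulVec_single, hb', vecMulVec_smul]⟩
  choose s hs using hs
  set Y : Matrix (Fin n) (Fin n) K := of fun k i => a i k
  set Z : Matrix (Fin n) (Fin n) K := of fun j l => b j l
  have hM : ∀ M, h M = Y * (of fun i j => M i j * s i j) * Z := by
    intro M
    conv_lhs => rw [matrix_eq_sum_single M]
    have h1 : ∀ i j, h (single i j (M i j)) = (M i j * s i j) • vecMulVec (a i) (b j) := by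
      intro i j
      rw [mul_smul, ← hs, ← map_smul, smul_single, smul_eq_mul, mul_one]
    simp only [map_sum, h1]
    ext k l
    simp only [Matrix.sum_apply, Matrix.smul_apply, vecMulVec_apply, mul_apply, of_apply, Y, Z,
      Finset.sum_mul, smul_eq_mul]
    rw [Finset.sum_comm]
    exact Finset.sum_congr rfl fun _ _ => Finset.sum_congr rfl fun _ _ => by ring
  have hunits : ∀ P Q : Matrix (Fin n) (Fin n) K, ∀ F : Matrix (Fin n) (Fin n) K → _,
      (∀ M, h M = P * F M * Q) → IsUnit P ∧ IsUnit Q := by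
    intro P Q F hF
    obtain ⟨M, h1⟩ := LinearMap.injective_iff_surjective.1 hinj 1
    rw [hF] at h1
    exact ⟨IsUnit.of_mul_eq_one _ (by rwa [mul_assoc] at h1),
      IsUnit.of_mul_eq_one_right _ h1⟩
  obtain ⟨hY, hZ⟩ := hunits Y Z _ hM
  obtain ⟨p, q, hpq⟩ := (hmin 1 1).exists_eq_vecMulVec
  have hS : of s = vecMulVec (hY.unit⁻¹.val *ᵥ p) (q ᵥ* hZ.unit⁻¹.val) := by
    rw [← vecMulVec_mul, ← mul_vecMulVec, ← hpq, hM, ← mul_assoc, ← mul_assoc, hY.val_inv_mul,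
      one_mul, mul_assoc, hZ.mul_val_inv, mul_one]
    ext i j
    simp [vecMulVec_apply]
  generalize hY.unit⁻¹.val *ᵥ p = α at hS
  generalize q ᵥ* hZ.unit⁻¹.val = β at hS
  have hM' : ∀ M, h M = (Y * diagonal α) * M * (diagonal β * Z) := by
    intro M
    have : (of fun i j => M i j * s i j) = diagonal α * M * diagonal β := by
      ext i j
      have := congrFun (congrFun hS i) j
      simp only [of_apply, vecMulVec_apply] at this
      rw [mul_diagonal, diagonal_mul, of_apply, this]
      ring
    rw [hM, this]
    simp only [mul_assoc]
  obtain ⟨hP, hQ⟩ := hunits _ _ id hM'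
  exact ⟨hP.unit, hQ.unit, hM'⟩

/-- One row with a common left factor forces common right factors on all columns, and then common left
factors on all rows. -/
theorem exists_GL_of_row_left (hn : 2 ≤ n) (hinj : Function.Injective h)
    (hmin : ∀ x φ, MinorsVanish (h (vecMulVec x φ))) {i₀ : Fin n}
    (hrow : ∃ a, ∀ φ, ∃ b, h (vecMulVec (Pi.single i₀ 1) φ) = vecMulVec a b) :
    ∃ P Q : GL (Fin n) K, ∀ M, h M = P.val * M * Q.val := by
  have : Nontrivial (Fin n) := Fin.nontrivial_iff_two_le.2 hn
  have hcol : ∀ j : Fin n, ∃ b, ∀ x, ∃ a, h (vecMulVec x (Pi.single j 1)) = vecMulVec a b := by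
    intro j
    refine (exists_common_factor (h.comp ((vecMulVecBilin K K).flip (Pi.single j 1)))
      fun x => hmin x _).resolve_left fun ⟨a', h'⟩ => ?_
    obtain ⟨a, ha⟩ := hrow
    obtain ⟨k, hk⟩ := exists_ne i₀
    exact not_row_and_column_left hinj hk ha h'
  refine exists_GL_of_rows_left_of_columns_right hinj hmin (fun i => ?_) hcol
  refine (exists_common_factor (h.comp (vecMulVecBilin K K (Pi.single i 1)))
    fun φ => hmin _ φ).resolve_right fun ⟨b, hb⟩ => ?_
  obtain ⟨k, hk⟩ := exists_ne i
  obtain ⟨b', hb'⟩ := hcol i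
  -- Row `i` and column `i` would both have common right factors: transpose the values of `h`.
  refine not_row_and_column_left
    (h := (transposeLinearEquiv (Fin n) (Fin n) K K).toLinearMap.comp h)
    ((transposeLinearEquiv (Fin n) (Fin n) K K).injective.comp hinj) (j := i) hk
    (a := b) (a' := b') (fun φ => ?_) (fun x => ?_)
  · obtain ⟨a, ha⟩ := hb φ
    exact ⟨a, (congrArg transpose ha).trans (transpose_vecMulVec _ _)⟩
  · obtain ⟨a, ha⟩ := hb' x
    exact ⟨a, (congrArg transpose ha).trans (transpose_vecMulVec _ _)⟩

theorem exists_GL_of_minorsVanish (hn : 2 ≤ n) (hinj : Function.Injective h)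
    (hmin : ∀ x φ, MinorsVanish (h (vecMulVec x φ))) :
    (∃ P Q : GL (Fin n) K, ∀ M, h M = P.val * M * Q.val) ∨
      ∃ P Q : GL (Fin n) K, ∀ M, h M = P.val * Mᵀ * Q.val := by
  let i : Fin n := ⟨0, by omega⟩
  rcases exists_common_factor (h.comp (vecMulVecBilin K K (Pi.single i 1))) fun φ => hmin _ φ with
    hrow | ⟨b, hb⟩
  · exact Or.inl (exists_GL_of_row_left hn hinj hmin hrow)
  · obtain ⟨P, Q, hPQ⟩ := exists_GL_of_row_left hn
      (h := (transposeLinearEquiv (Fin n) (Fin n) K K).toLinearMap.comp h)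
      ((transposeLinearEquiv (Fin n) (Fin n) K K).injective.comp hinj)
      (fun x φ => (hmin x φ).transpose) (i₀ := i) ⟨b, fun φ => by
        obtain ⟨a, ha⟩ := hb φ
        exact ⟨a, (congrArg transpose ha).trans (transpose_vecMulVec _ _)⟩⟩
    refine Or.inr ⟨transposeGL Q, transposeGL P, fun M => ?_⟩
    have h1 : (h M)ᵀ = P.val * M * Q.val := hPQ M
    rw [← transpose_transpose (h M), h1]
    simp [transposeGL, transpose_mul, mul_assoc]

end RankOnePreservers

/-! ### Adjoints for the trace pairing -/

variable {n : ℕ}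

theorem trace_mul_of_functional (g : Matrix (Fin n) (Fin n) K →ₗ[K] K)
    (M : Matrix (Fin n) (Fin n) K) : trace (M * of fun i j => g (single j i 1)) = g M := by
  conv_rhs => rw [matrix_eq_sum_single M]
  have h1 : ∀ i j, g (single i j (M i j)) = M i j * g (single i j 1) := by
    intro i j
    rw [← smul_eq_mul, ← map_smul, smul_single, smul_eq_mul, mul_one]
  simp only [map_sum, h1, trace, diag_apply, mul_apply, of_apply]

/-- The adjoint of `f` for the pairing `(A, B) ↦ tr (A B)`, given by its entries. -/
def traceAdjoint (f : Module.End K (Matrix (Fin n) (Fin n) K)) :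
    Module.End K (Matrix (Fin n) (Fin n) K) where
  toFun B := of fun i j => trace (f (single j i 1) * B)
  map_add' B C := by ext; simp [mul_add]
  map_smul' c B := by ext; simp

theorem trace_mul_traceAdjoint (f : Module.End K (Matrix (Fin n) (Fin n) K))
    (M B : Matrix (Fin n) (Fin n) K) : trace (M * traceAdjoint f B) = trace (f M * B) :=
  trace_mul_of_functional
    (((traceLinearMap (Fin n) K K).comp (LinearMap.mulRight K B)).comp f) M

theorem traceAdjoint_injective {f : Module.End K (Matrix (Fin n) (Fin n) K)}
    (hf : Function.Surjective f) : Function.Injective (traceAdjoint f) := by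
  rw [injective_iff_map_eq_zero]
  intro B hB
  refine ext_iff_trace_mul_left.2 fun N => ?_
  obtain ⟨M, rfl⟩ := hf N
  rw [← trace_mul_traceAdjoint, hB]; simp

/-! ### The Frobenius group and the preservers of non-singularity -/

theorem mem_frobeniusMaps_iff {f : Module.End K (Matrix (Fin n) (Fin n) K)} :
    f ∈ frobeniusMaps n K ↔ (∃ P Q, f = u P Q) ∨ ∃ P Q, f = v P Q := by
  constructor
  · rintro ⟨g, hg, rfl⟩
    exact hg
  · have e : ∀ A : GL (Fin n) K, transposeGL (transposeGL A) = A := fun A => Units.ext rfl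
    rintro (⟨P, Q, rfl⟩ | ⟨P, Q, rfl⟩)
    · exact ⟨⟨u P Q, u P⁻¹ Q⁻¹, by simp [u_mul_u, u_one], by simp [u_mul_u, u_one]⟩,
        Or.inl ⟨P, Q, rfl⟩, rfl⟩
    · have e1 : ∀ A : GL (Fin n) K, transposeGL A⁻¹ * transposeGL A = 1 := fun A =>
        Units.ext (by simp [transposeGL, ← transpose_mul])
      have e2 : ∀ A : GL (Fin n) K, transposeGL A * transposeGL A⁻¹ = 1 := fun A =>
        Units.ext (by simp [transposeGL, ← transpose_mul])
      exact ⟨⟨v P Q, v (transposeGL Q⁻¹) (transposeGL P⁻¹), by simp [v_mul_v, e, u_one],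
        by simp [v_mul_v, e1, e2, u_one]⟩, Or.inr ⟨P, Q, rfl⟩, rfl⟩

theorem bijective_of_mem_frobeniusMaps {f : Module.End K (Matrix (Fin n) (Fin n) K)}
    (hf : f ∈ frobeniusMaps n K) : Function.Bijective f := by
  obtain ⟨g, -, rfl⟩ := hf
  exact (Module.End.isUnit_iff _).1 g.isUnit

theorem isUnit_apply_iff_of_mem_frobeniusMaps {f : Module.End K (Matrix (Fin n) (Fin n) K)}
    (hf : f ∈ frobeniusMaps n K) (M : Matrix (Fin n) (Fin n) K) : IsUnit (f M) ↔ IsUnit M := by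
  rcases mem_frobeniusMaps_iff.1 hf with ⟨P, Q, rfl⟩ | ⟨P, Q, rfl⟩
  · simp [u]
  · simp [v]

theorem mem_frobeniusMaps_of_bijective_of_two_le (hn : 2 ≤ n)
    {f : Module.End K (Matrix (Fin n) (Fin n) K)} (hf : Function.Bijective f)
    (hGL : ∀ M, IsUnit M → IsUnit (f M)) : f ∈ frobeniusMaps n K := by
  have hinj := traceAdjoint_injective hf.2
  have hmin : ∀ x φ, MinorsVanish (traceAdjoint f (vecMulVec x φ)) := by
    intro x φ
    by_cases hx : x = 0
    · subst hx
      rw [zero_vecMulVec, map_zero]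
      intro i k j l; simp
    by_contra hcon
    have hJ : Function.Injective ((traceAdjoint f).comp
        (vecMulVecBilin K K x : (Fin n → K) →ₗ[K] Matrix (Fin n) (Fin n) K)) := by
      refine hinj.comp ((injective_iff_map_eq_zero _).2 fun φ h => ?_)
      exact (vecMulVec_eq_zero.1 h).resolve_left hx
    -- A matrix `P` orthogonal to all `h (x φᵀ)` has `tr (f(P) x φᵀ) = 0` for all `φ`.
    obtain ⟨P, hP⟩ := exists_GL_trace_eq_zero hn _
      ((LinearMap.finrank_range_of_inj hJ).trans (finrank_fin_fun K)) ⟨φ, rfl⟩ hcon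
    refine hx ((mulVec_injective_iff_isUnit.2 (hGL P P.isUnit)) ?_)
    rw [mulVec_zero]
    refine dotProduct_eq_zero _ fun φ => ?_
    have := hP _ ⟨φ, rfl⟩
    rw [LinearMap.comp_apply, trace_mul_traceAdjoint, vecMulVecBilin_apply_apply, mul_vecMulVec,
      trace_vecMulVec] at this
    exact this
  rw [mem_frobeniusMaps_iff]
  rcases exists_GL_of_minorsVanish hn hinj hmin with ⟨P, Q, h⟩ | ⟨P, Q, h⟩
  · refine Or.inl ⟨Q, P, LinearMap.ext fun M => ext_iff_trace_mul_right.2 fun B => ?_⟩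
    rw [← trace_mul_traceAdjoint, h]
    change _ = trace (Q.val * M * P.val * B)
    rw [← mul_assoc, trace_mul_comm]
    simp only [mul_assoc]
  · refine Or.inr ⟨transposeGL P, transposeGL Q,
      LinearMap.ext fun M => ext_iff_trace_mul_right.2 fun B => ?_⟩
    rw [← trace_mul_traceAdjoint, h]
    have h1 : trace (P.valᵀ * Mᵀ * Q.valᵀ * B) = trace (Bᵀ * Q.val * (M * P.val)) := by
      rw [← trace_transpose]
      simp [mul_assoc]
    refine Eq.trans ?_ h1.symm
    rw [trace_mul_comm (Bᵀ * Q.val)]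
    simp only [mul_assoc]

theorem mem_frobeniusMaps_of_bijective (hn : 0 < n)
    {f : Module.End K (Matrix (Fin n) (Fin n) K)} (hf : Function.Bijective f)
    (hGL : ∀ M, IsUnit M → IsUnit (f M)) : f ∈ frobeniusMaps n K := by
  obtain rfl | h : n = 1 ∨ 2 ≤ n := by omega
  · refine mem_frobeniusMaps_iff.2 (Or.inl ⟨(hGL 1 isUnit_one).unit, 1, LinearMap.ext fun M => ?_⟩)
    have hM : ∀ M : Matrix (Fin 1) (Fin 1) K, M = M 0 0 • 1 := fun M => by
      ext i j; simp [Subsingleton.elim i 0, Subsingleton.elim j 0]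
    change f M = f 1 * M * 1
    rw [mul_one]
    conv_lhs => rw [hM M]
    conv_rhs => rw [hM M]
    simp
  · exact mem_frobeniusMaps_of_bijective_of_two_le h hf hGL

/-- For `n ≥ 2` the single condition `tr (P B) = 1` has an invertible solution. -/
theorem exists_isUnit_trace_ne_zero {B : Matrix (Fin n) (Fin n) K} (hB : B ≠ 0) :
    ∃ P, IsUnit P ∧ trace (P * B) ≠ 0 := by
  obtain h0 | rfl | h : n = 0 ∨ n = 1 ∨ 2 ≤ n := by omega
  · subst h0; exact absurd (Subsingleton.elim B 0) hB
  · refine ⟨1, isUnit_one, fun h => hB ?_⟩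
    ext i j
    simpa [Subsingleton.elim i 0, Subsingleton.elim j 0, trace] using h
  · obtain ⟨P, hP⟩ := smallSystemsSolvable n (K ∙ B)
      (LinearEquiv.toSpanNonzeroSingleton K _ B hB).symm.toLinearMap
      (by rw [finrank_span_singleton hB]; omega)
    refine ⟨P, P.isUnit, ?_⟩
    have h1 : (LinearEquiv.toSpanNonzeroSingleton K _ B hB).symm
        ⟨B, Submodule.mem_span_singleton_self B⟩ = 1 := by
      rw [LinearEquiv.symm_apply_eq, LinearEquiv.toSpanNonzeroSingleton_one]
    rw [show trace (P.val * B) = 1 from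
      (hP ⟨B, Submodule.mem_span_singleton_self B⟩).trans h1]
    exact one_ne_zero

theorem span_nonsingular : Submodule.span K (nonsingular n K) = ⊤ := by
  by_contra h
  obtain ⟨g, hg, hle⟩ := Submodule.exists_le_ker_of_lt_top _ (lt_top_iff_ne_top.2 h)
  have hB : (of fun i j => g (single j i 1)) ≠ 0 := by
    intro h0
    refine hg (LinearMap.ext fun M => ?_)
    rw [← trace_mul_of_functional g M, h0]; simp
  obtain ⟨P, hP, hne⟩ := exists_isUnit_trace_ne_zero hB
  rw [trace_mul_of_functional] at hne
  exact hne (hle (Submodule.subset_span hP))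

theorem bijective_of_isUnit_apply_iff {f : Module.End K (Matrix (Fin n) (Fin n) K)}
    (hf : ∀ M, IsUnit (f M) ↔ IsUnit M) : Function.Bijective f := by
  suffices h : Function.Injective f from ⟨h, LinearMap.injective_iff_surjective.1 h⟩
  rw [injective_iff_map_eq_zero]
  intro A hA
  by_contra hne
  obtain ⟨d, hd⟩ : ∃ d, A *ᵥ d ≠ 0 := by
    by_contra! h
    exact hne (Matrix.ext_of_mulVec_single fun i =>
      (h (Pi.single i 1)).trans (zero_mulVec _).symm)
  have hd0 : d ≠ 0 := by rintro rfl; simp at hd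
  obtain ⟨P, hP⟩ := exists_GL_mulVec_eq hd0 hd
  have h1 : IsUnit (P.val - A) := by
    rw [← hf, map_sub, hA, sub_zero, hf]
    exact P.isUnit
  refine hd0 (mulVec_injective_iff_isUnit.2 h1 ?_)
  rw [sub_mulVec, hP]; simp

open Fin.CommRing in
/-- Every singular `M` is `N P` with `P` invertible and `N` nilpotent; then `M + t P = (N + t) P` is
invertible for `t ≠ 0`. Concretely, `M` is equivalent to a diagonal matrix with a zero entry, and
`P` corresponds to a cyclic permutation matrix. -/
theorem exists_isUnit_add_smul {M : Matrix (Fin n) (Fin n) K} (hM : ¬ IsUnit M) :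
    ∃ P, IsUnit P ∧ ∀ t : K, t ≠ 0 → IsUnit (M + t • P) := by
  obtain ⟨L, L', D, hD⟩ := Pivot.exists_list_transvec_mul_diagonal_mul_list_transvec M
  set A := (L.map TransvectionStruct.toMatrix).prod
  set A' := (L'.map TransvectionStruct.toMatrix).prod
  have hA : IsUnit A := by
    rw [isUnit_iff_isUnit_det]; simp [A]
  have hA' : IsUnit A' := by
    rw [isUnit_iff_isUnit_det]; simp [A']
  obtain ⟨k, hk⟩ : ∃ k, D k = 0 := by
    by_contra! h
    refine hM ?_
    rw [hD]
    refine (hA.mul ?_).mul hA'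
    rw [isUnit_iff_isUnit_det, det_diagonal, isUnit_iff_ne_zero]
    exact Finset.prod_ne_zero_iff.2 fun i _ => h i
  obtain ⟨m, rfl⟩ : ∃ m, n = m + 1 := ⟨n - 1, by have := k.isLt; omega⟩
  let C : Matrix (Fin (m + 1)) (Fin (m + 1)) K := of fun i j => if j = i + 1 then 1 else 0
  have hC : ∀ x i, (C *ᵥ x) i = x (i + 1) := by
    intro x i
    simp [C, mulVec, dotProduct]
  refine ⟨A * C * A', (hA.mul ?_).mul hA', fun t ht => ?_⟩
  · refine mulVec_injective_iff_isUnit.1 fun x y h => funext fun i => ?_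
    have := congrFun h (i - 1)
    simpa [hC] using this
  · have : M + t • (A * C * A') = A * (diagonal D + t • C) * A' := by
      rw [hD]; simp [mul_add, add_mul]
    rw [this]
    refine (hA.mul (mulVec_injective_iff_isUnit.1 ?_)).mul hA'
    refine (injective_iff_map_eq_zero (mulVecLin (diagonal D + t • C))).2 fun x hx => ?_
    have hx' : ∀ i, D i * x i + t * x (i + 1) = 0 := by
      intro i
      have := congrFun hx i
      simpa [add_mulVec, smul_mulVec, hC, mulVec_diagonal] using this
    -- From the zero entry `D k = 0`, the vanishing of `x` propagates around the cycle.
    have hstep : ∀ r : ℕ, x (k + 1 + (r : Fin (m + 1))) = 0 := by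
      intro r
      induction r with
      | zero => simpa [hk, ht] using hx' k
      | succ r ih =>
        have := hx' (k + 1 + (r : Fin (m + 1)))
        rw [ih] at this
        simpa [ht, add_assoc] using this
    funext i
    have := hstep ((i - (k + 1) : Fin (m + 1)) : ℕ)
    simpa using this

theorem isUnit_of_isUnit_apply [IsAlgClosed K] (hn : 0 < n)
    {f : Module.End K (Matrix (Fin n) (Fin n) K)} (hGL : ∀ M, IsUnit M → IsUnit (f M))
    {M : Matrix (Fin n) (Fin n) K} (hM : IsUnit (f M)) : IsUnit M := by
  by_contra hcon
  obtain ⟨P, hP, ht⟩ := exists_isUnit_add_smul hcon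
  have : Nonempty (Fin n) := ⟨⟨0, hn⟩⟩
  obtain ⟨μ, hμ⟩ := spectrum.nonempty_of_isAlgClosed_of_finiteDimensional K
    ((hGL P hP).unit⁻¹.val * f M)
  rw [spectrum.mem_iff] at hμ
  have h1 : f (M + (-μ) • P) =
      -((hGL P hP).unit.val *
        (algebraMap K _ μ - (hGL P hP).unit⁻¹.val * f M)) := by
    rw [mul_sub, Units.mul_inv_cancel_left, IsUnit.unit_spec, map_add, map_smul,
      Algebra.algebraMap_eq_smul_one, mul_smul_comm, mul_one, neg_smul]
    abel
  by_cases h0 : μ = 0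
  · subst h0
    rw [neg_zero, zero_smul, add_zero] at h1
    rw [h1, IsUnit.neg_iff, Units.isUnit_units_mul] at hM
    exact hμ hM
  · have h2 := hGL _ (ht (-μ) (neg_ne_zero.2 h0))
    rw [h1, IsUnit.neg_iff, Units.isUnit_units_mul] at h2
    exact hμ h2

end Frobenius

theorem theorem1 (n : ℕ) (hn : 0 < n) (K : Type*) [Field K] :
    -- the endomorphisms `f` with `f(GL_n) = GL_n`
    (Frobenius.frobeniusMaps n K =
      {f : Module.End K (Matrix (Fin n) (Fin n) K) |
        f '' Frobenius.nonsingular n K = Frobenius.nonsingular n K}) ∧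
    -- the endomorphisms `f` with `f⁻¹(GL_n) = GL_n` (inverse image)
    (Frobenius.frobeniusMaps n K =
      {f : Module.End K (Matrix (Fin n) (Fin n) K) |
        f ⁻¹' Frobenius.nonsingular n K = Frobenius.nonsingular n K}) ∧
    -- the bijective endomorphisms `f` with `f(GL_n) ⊆ GL_n`
    (Frobenius.frobeniusMaps n K =
      {f : Module.End K (Matrix (Fin n) (Fin n) K) |
        Function.Bijective f ∧
          f '' Frobenius.nonsingular n K ⊆ Frobenius.nonsingular n K}) ∧
    -- over an algebraically closed field, the endomorphisms `f` with `f(GL_n) ⊆ GL_n`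
    (IsAlgClosed K →
      Frobenius.frobeniusMaps n K =
        {f : Module.End K (Matrix (Fin n) (Fin n) K) |
          f '' Frobenius.nonsingular n K ⊆ Frobenius.nonsingular n K}) := by
  have hpre : ∀ f ∈ Frobenius.frobeniusMaps n K,
      f ⁻¹' Frobenius.nonsingular n K = Frobenius.nonsingular n K :=
    fun f hf => Set.ext fun M => Frobenius.isUnit_apply_iff_of_mem_frobeniusMaps hf M
  have himg : ∀ f ∈ Frobenius.frobeniusMaps n K,
      f '' Frobenius.nonsingular n K = Frobenius.nonsingular n K := fun f hf => by
    conv_lhs => rw [← hpre f hf]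
    exact Set.image_preimage_eq _ (Frobenius.bijective_of_mem_frobeniusMaps hf).2
  have hof_iff : ∀ f : Module.End K (Matrix (Fin n) (Fin n) K),
      (∀ M, IsUnit (f M) ↔ IsUnit M) → f ∈ Frobenius.frobeniusMaps n K := fun f hf =>
    Frobenius.mem_frobeniusMaps_of_bijective hn (Frobenius.bijective_of_isUnit_apply_iff hf)
      fun M => (hf M).2
  refine ⟨Set.Subset.antisymm himg fun f hf => ?_, Set.Subset.antisymm hpre fun f hf => ?_,
    Set.Subset.antisymm (fun f hf => ⟨Frobenius.bijective_of_mem_frobeniusMaps hf,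
      (himg f hf).subset⟩) fun f hf => ?_,
    fun hK => Set.Subset.antisymm (fun f hf => (himg f hf).subset) fun f hf => ?_⟩
  · have hf' : f '' Frobenius.nonsingular n K = Frobenius.nonsingular n K := hf
    have hsurj : Function.Surjective f := by
      rw [← LinearMap.range_eq_top, eq_top_iff, ← Frobenius.span_nonsingular, ← hf',
        Submodule.span_le]
      exact Set.image_subset_range _ _
    exact Frobenius.mem_frobeniusMaps_of_bijective hn
      ⟨LinearMap.injective_iff_surjective.2 hsurj, hsurj⟩
      fun M hM => hf'.subset ⟨M, hM, rfl⟩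
  · exact hof_iff f fun M => Set.ext_iff.1 hf M
  · exact Frobenius.mem_frobeniusMaps_of_bijective hn hf.1 fun M hM => hf.2 ⟨M, hM, rfl⟩
  · have hGL : ∀ M, IsUnit M → IsUnit (f M) := fun M hM => hf ⟨M, hM, rfl⟩
    exact hof_iff f fun M => ⟨Frobenius.isUnit_of_isUnit_apply hn hGL, hGL M⟩
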